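/- Let $d\ge 0$ and $k$ be integers with $k>1+d/2$, and let $\chi\in C^k(\mathbb R^d;\mathbb C)$ be a cut-off function supported in the ball $B^d(0,2)$ with $\chi\equiv 1$ on $B^d(0,1)$. For $\tau>0$ let $\Pi_\tau$ be the frequency cut-off on $L^2(\mathbb R^d)$ defined by $\widehat{\Pi_\tau\phi}(\xi)=\chi(\tau^{1/2}\xi)\widehat\phi(\xi)$, where $\widehat\phi(\xi)=\int_{\mathbb R^d}e^{-ix\cdot\xi}\phi(x)\,dx$ (extended to $L^2$), acting componentwise on vector-valued functions. Let $\Sigma=\{\phi\in H^1(\mathbb R^d):\int_{\mathbb R^d}|x|^2|\phi(x)|^2dx<\infty\}$ (complex-valued functions), and for $t\in\mathbb R$, $\phi\in\Sigma$ let $J(t)\phi=x\phi+it\nabla\phi\in L^2(\mathbb R^d)^d$. Then for every $1<p<\infty$ there exists a constant $C_p>0$ (depending only on $p$, $d$ and $\chi$) such that for all $\tau>0$, all $\phi\in\Sigma$ and all $t\in\mathbb R$, one has $\Pi_\tau\phi\in\Sigma$ and $$\left\|J(t)\Pi_\tau\phi-\Pi_\tau J(t)\phi\right\|_{L^p}\le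 C_p\,\tau^{1/2}\,\|\phi\|_{L^p},$$ where the $L^p$ norm of a $\mathbb C^d$-valued function is that of its Euclidean length, and the right-hand side is $+\infty$ if $\phi\notin L^p(\mathbb R^d)$. -/

import Mathlib

open MeasureTheory TemperedDistribution
open scoped ENNReal FourierTransform SchwartzMap LineDeriv

noncomputable section

/-- Complex-valued square integrable functions on `ℝ^d`. -/
abbrev L2Space (d : ℕ) : Type := Lp (α := EuclideanSpace ℝ (Fin d)) ℂ 2

/-- The conformal space `Σ`: functions in `H¹(ℝ^d)` with `∫ |x|² |φ(x)|² dx < ∞`. -/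
def conformalSpace (d : ℕ) : Set (L2Space d) :=
  {φ | MemSobolev 1 2 (φ : 𝓢'(EuclideanSpace ℝ (Fin d), ℂ)) ∧
    ∫⁻ x : EuclideanSpace ℝ (Fin d), ‖x‖ₑ ^ 2 * ‖φ x‖ₑ ^ 2 < ∞}

theorem memLp_coord_mul {d : ℕ} {φ : L2Space d} (hφ : φ ∈ conformalSpace d) (j : Fin d) :
    MemLp (fun x : EuclideanSpace ℝ (Fin d) => (x j : ℂ) * φ x) 2 := by
  refine ⟨?_, ?_⟩
  · have h : Continuous fun x : EuclideanSpace ℝ (Fin d) => (x j : ℂ) := by fun_prop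
    exact h.aestronglyMeasurable.mul (Lp.aestronglyMeasurable φ)
  · rw [eLpNorm_lt_top_iff_lintegral_rpow_enorm_lt_top (by norm_num) (by norm_num)]
    refine lt_of_le_of_lt (lintegral_mono fun x => ?_) hφ.2
    have hx : ‖(x j : ℂ)‖ₑ ≤ ‖x‖ₑ := by
      rw [enorm_le_iff_norm_le, Complex.norm_real]
      exact PiLp.norm_apply_le x j
    simp only [ENNReal.toReal_ofNat, ENNReal.rpow_ofNat, enorm_mul]
    rw [mul_pow]
    gcongr

theorem exists_weakPartial {d : ℕ} {φ : L2Space d} (hφ : φ ∈ conformalSpace d) (j : Fin d) :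
    ∃ g : L2Space d, (∂_{EuclideanSpace.single j (1 : ℝ)}
      (φ : 𝓢'(EuclideanSpace ℝ (Fin d), ℂ)) : 𝓢'(EuclideanSpace ℝ (Fin d), ℂ)) = g := by
  have h := hφ.1.lineDerivOp (m := EuclideanSpace.single j (1 : ℝ))
  rw [sub_self, memSobolev_zero_iff] at h
  obtain ⟨g, hg⟩ := h
  exact ⟨g, hg⟩

/-- The weak partial derivative `∂_j φ ∈ L²` of `φ ∈ Σ` (unique, since an `L²` function is
determined by the tempered distribution it defines). -/
def weakPartial {d : ℕ} (φ : conformalSpace d) (j : Fin d) : L2Space d :=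
  (exists_weakPartial φ.2 j).choose

/-- The `j`-th component `x_j φ + i t ∂_j φ` of `J(t) φ = x φ + i t ∇ φ`, for `φ ∈ Σ`. -/
def opJ {d : ℕ} (t : ℝ) (φ : conformalSpace d) (j : Fin d) : L2Space d :=
  (memLp_coord_mul φ.2 j).toLp _ + (Complex.I * t) • weakPartial φ j

/-- `χ ∈ C^k(ℝ^d)`, with `k > 1 + d / 2`, is supported in the ball of radius `2` and equal to `1`
on the unit ball. -/
structure IsCutoff (d k : ℕ) (χ : EuclideanSpace ℝ (Fin d) → ℂ) : Prop where
  order : 1 + (d : ℝ) / 2 < k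
  contDiff : ContDiff ℝ k χ
  support : tsupport χ ⊆ Metric.closedBall 0 2
  eq_one : ∀ ξ ∈ Metric.ball (0 : EuclideanSpace ℝ (Fin d)) 1, χ ξ = 1

theorem IsCutoff.memLp_mul {d k : ℕ} {χ : EuclideanSpace ℝ (Fin d) → ℂ} (hχ : IsCutoff d k χ)
    (c : ℝ) (f : L2Space d) : MemLp (fun ξ : EuclideanSpace ℝ (Fin d) => χ (c • ξ) * f ξ) 2 := by
  have hc : Continuous χ := hχ.contDiff.continuous
  have hs : HasCompactSupport χ :=
    (isCompact_closedBall _ _).of_isClosed_subset (isClosed_tsupport χ) hχ.support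
  obtain ⟨B, hB⟩ := hc.bounded_above_of_compact_support hs
  have hm : Continuous fun ξ : EuclideanSpace ℝ (Fin d) => χ (c • ξ) := by fun_prop
  refine MemLp.of_le_mul (Lp.memLp f) (c := B)
    (hm.aestronglyMeasurable.mul (Lp.aestronglyMeasurable f)) (ae_of_all _ fun ξ => ?_)
  rw [norm_mul]
  gcongr
  exact hB _

/-- The frequency cut-off `Π_τ`, acting on `L²` as the Fourier multiplier with symbol
`χ(τ^{1/2} ξ)`, where `ξ` is the frequency of the transform `∫ e^{-i x·ξ} f(x) dx`. Mathlib's `𝓕`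
is `∫ e^{-2πi x·ξ} f(x) dx`, hence the factor `2π`. -/
def freqCutoff {d k : ℕ} {χ : EuclideanSpace ℝ (Fin d) → ℂ} (hχ : IsCutoff d k χ) (τ : ℝ)
    (f : L2Space d) : L2Space d :=
  𝓕⁻ ((hχ.memLp_mul (τ ^ (1 / 2 : ℝ) * (2 * Real.pi)) (𝓕 f)).toLp _ : L2Space d)

end

/-!
The cut-off `Π_τ` is convolution with `K_a(x) = a^(-d) K(x / a)`, where `K = 𝓕⁻ χ` and
`a = 2π τ^(1/2)` (`freqCutoff_eq_convolutionL2`). Since `x_j = y_j + (x_j - y_j)`,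

  `x_j (K_a * φ)(x) - (K_a * (x_j φ))(x) = ∫ y_j K_a(y) φ(x - y) dy`,

so the commutator of multiplication by `x_j` with `Π_τ` is convolution with `y_j K_a(y)`
(`ae_enorm_commutator_convolution_le`), whose `L¹` norm is at most `a ∫ |y| |K(y)| dy`
(`lintegral_enorm_mul_enorm_dilate`). Young's inequality (`eLpNorm_le_of_enorm_le_lintegral`) then
bounds it on `L^p` by a multiple of `τ^(1/2)`. The gradient is a Fourier multiplier, hence commutes
with `Π_τ` and does not contribute (`weakPartial_freqCutoff`).

The point is therefore that `(1 + |y|) K(y)` is integrable. As `χ` is `C^k` with compact support,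
Plancherel's theorem applied to `χ` and to its derivatives of order `k` shows that
`(1 + |y|)^k K` is square integrable, and `(1 + |y|)^(1 - k)` is square integrable because
`2 (k - 1) > d`; the product of the two is integrable (`integrable_one_add_norm_mul_fourier`).

The same weight gives `|x| Π_τ φ ∈ L²` for `φ ∈ Σ`, and `Π_τ` preserves `H¹` because it commutes
with Bessel potentials, so `Π_τ` maps `Σ` to itself (`freqCutoff_mem_conformalSpace`).
-/

/-! ### Convolution with an integrable kernel -/

section Convolution

open scoped Convolution

variable {E : Type*} [NormedAddCommGroup E] [InnerProductSpace ℝ E] [FiniteDimensional ℝ E]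
  [MeasurableSpace E] [BorelSpace E]

/-- Hölder's inequality for the measure with density `K`. -/
theorem lintegral_mul_rpow_le {α : Type*} [MeasurableSpace α] {μ : Measure α} {K f : α → ℝ≥0∞}
    (hK : AEMeasurable K μ) (hf : AEMeasurable f μ) {p : ℝ} (hp : 1 ≤ p) :
    (∫⁻ y, K y * f y ∂μ) ^ p ≤ (∫⁻ y, K y ∂μ) ^ (p - 1) * ∫⁻ y, K y * f y ^ p ∂μ := by
  have hp0 : 0 < p := one_pos.trans_le hp
  have hq : 0 ≤ 1 - p⁻¹ := sub_nonneg.2 (inv_le_one_of_one_le₀ hp)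
  -- Hölder for the splitting `K f = K ^ (1 - 1 / p) * (K * f ^ p) ^ (1 / p)`
  have key := ENNReal.lintegral_mul_norm_pow_le (μ := μ) hK (hK.mul (hf.pow_const p)) hq
    (inv_nonneg.2 hp0.le) (by ring)
  have e : ∀ y, K y ^ (1 - p⁻¹) * (K y * f y ^ p) ^ p⁻¹ = K y * f y := fun y => by
    rw [ENNReal.mul_rpow_of_nonneg _ _ (inv_nonneg.2 hp0.le), ← mul_assoc,
      ← ENNReal.rpow_add_of_nonneg _ _ hq (inv_nonneg.2 hp0.le), ENNReal.rpow_rpow_inv hp0.ne']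
    simp
  simp only [Pi.mul_apply, e] at key
  calc (∫⁻ y, K y * f y ∂μ) ^ p
      ≤ ((∫⁻ y, K y ∂μ) ^ (1 - p⁻¹) * (∫⁻ y, K y * f y ^ p ∂μ) ^ p⁻¹) ^ p := by gcongr
    _ = _ := by
      rw [ENNReal.mul_rpow_of_nonneg _ _ hp0.le, ← ENNReal.rpow_mul, ENNReal.rpow_inv_rpow hp0.ne']
      congr 2
      field_simp

/-- Young's inequality `L¹ * L^p → L^p` for nonnegative functions. -/
theorem lintegral_rpow_lintegral_mul_sub_le {K f : E → ℝ≥0∞} (hK : AEMeasurable K)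
    (hf : AEMeasurable f) {p : ℝ} (hp : 1 ≤ p) :
    ∫⁻ x, (∫⁻ y, K y * f (x - y)) ^ p ≤ (∫⁻ y, K y) ^ p * ∫⁻ x, f x ^ p := by
  have hp0 : 0 < p := one_pos.trans_le hp
  have hsub : AEMeasurable (fun z : E × E => f (z.1 - z.2)) (volume.prod volume) :=
    hf.comp_quasiMeasurePreserving (quasiMeasurePreserving_sub_of_right_invariant volume volume)
  calc ∫⁻ x, (∫⁻ y, K y * f (x - y)) ^ p
      ≤ ∫⁻ x, (∫⁻ y, K y) ^ (p - 1) * ∫⁻ y, K y * f (x - y) ^ p := by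
        refine lintegral_mono fun x => lintegral_mul_rpow_le hK ?_ hp
        exact hf.comp_quasiMeasurePreserving
          (quasiMeasurePreserving_sub_left_of_right_invariant volume x)
    _ = (∫⁻ y, K y) ^ (p - 1) * ∫⁻ x, ∫⁻ y, K y * f (x - y) ^ p :=
        lintegral_const_mul'' _ (((hK.comp_snd).mul (hsub.pow_const p)).lintegral_prod_right')
    _ = (∫⁻ y, K y) ^ (p - 1) * ((∫⁻ y, K y) * ∫⁻ x, f x ^ p) := by
        congr 1
        rw [lintegral_lintegral_swap ((hK.comp_snd).mul (hsub.pow_const p)),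
          ← lintegral_mul_const'' _ hK]
        refine lintegral_congr fun y => ?_
        have hy : AEMeasurable (fun x => f (x - y)) :=
          hf.comp_quasiMeasurePreserving (measurePreserving_sub_right volume y).quasiMeasurePreserving
        rw [lintegral_const_mul'' _ (hy.pow_const p),
          lintegral_sub_right_eq_self (fun x => f x ^ p) y]
    _ = (∫⁻ y, K y) ^ p * ∫⁻ x, f x ^ p := by
        rw [← mul_assoc]
        congr 1
        conv_lhs => rw [← ENNReal.rpow_one (∫⁻ y, K y), ← ENNReal.rpow_mul, one_mul]
        rw [← ENNReal.rpow_add_of_nonneg _ _ (sub_nonneg.2 hp) zero_le_one, sub_add_cancel]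

/-- Young's inequality for any function dominated by the convolution of the absolute values. -/
theorem eLpNorm_le_of_enorm_le_lintegral {F : Type*} [NormedAddCommGroup F] {K : E → ℝ≥0∞}
    {f : E → ℂ} {g : E → F} (hK : AEMeasurable K) (hf : AEStronglyMeasurable f) {p : ℝ≥0∞}
    (hp : 1 ≤ p) (hp' : p ≠ ∞) (hg : ∀ᵐ x, ‖g x‖ₑ ≤ ∫⁻ y, K y * ‖f (x - y)‖ₑ) :
    eLpNorm g p ≤ (∫⁻ y, K y) * eLpNorm f p := by
  have hp0 : p ≠ 0 := (one_pos.trans_le hp).ne'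
  have hp1 : 1 ≤ p.toReal := by simpa using (ENNReal.toReal_le_toReal (by simp) hp').2 hp
  have hpos : 0 < p.toReal := one_pos.trans_le hp1
  rw [eLpNorm_eq_lintegral_rpow_enorm_toReal hp0 hp', eLpNorm_eq_lintegral_rpow_enorm_toReal hp0 hp']
  calc (∫⁻ x, ‖g x‖ₑ ^ p.toReal) ^ (1 / p.toReal)
      ≤ (∫⁻ x, (∫⁻ y, K y * ‖f (x - y)‖ₑ) ^ p.toReal) ^ (1 / p.toReal) := by
        gcongr ?_ ^ _
        refine lintegral_mono_ae ?_
        filter_upwards [hg] with x hx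
        gcongr
    _ ≤ ((∫⁻ y, K y) ^ p.toReal * ∫⁻ x, ‖f x‖ₑ ^ p.toReal) ^ (1 / p.toReal) := by
        gcongr
        exact lintegral_rpow_lintegral_mul_sub_le hK hf.enorm hp1
    _ = _ := by
        rw [ENNReal.mul_rpow_of_nonneg _ _ (by positivity), one_div,
          ENNReal.rpow_rpow_inv hpos.ne']

theorem enorm_convolution_mul_le (K f : E → ℂ) (x : E) :
    ‖(K ⋆[ContinuousLinearMap.mul ℂ ℂ] f) x‖ₑ ≤ ∫⁻ y, ‖K y‖ₑ * ‖f (x - y)‖ₑ := by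
  simpa [convolution_def, enorm_mul] using
    enorm_integral_le_lintegral_enorm (μ := volume) fun y => K y * f (x - y)

variable {K f : E → ℂ}

theorem aestronglyMeasurable_convolution_mul (hK : AEStronglyMeasurable K)
    (hf : AEStronglyMeasurable f) :
    AEStronglyMeasurable (K ⋆[ContinuousLinearMap.mul ℂ ℂ] f) volume :=
  (hK.convolution_integrand (ContinuousLinearMap.mul ℂ ℂ) hf).integral_prod_right'

theorem eLpNorm_convolution_mul_le (hK : AEStronglyMeasurable K) (hf : AEStronglyMeasurable f)
    {p : ℝ≥0∞} (hp : 1 ≤ p) (hp' : p ≠ ∞) :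
    eLpNorm (K ⋆[ContinuousLinearMap.mul ℂ ℂ] f) p ≤ (∫⁻ y, ‖K y‖ₑ) * eLpNorm f p :=
  eLpNorm_le_of_enorm_le_lintegral hK.enorm hf hp hp' (ae_of_all _ (enorm_convolution_mul_le K f))

theorem MeasureTheory.MemLp.convolution_mul {p : ℝ≥0∞} (hf : MemLp f p) (hK : Integrable K)
    (hp : 1 ≤ p) (hp' : p ≠ ∞) : MemLp (K ⋆[ContinuousLinearMap.mul ℂ ℂ] f) p :=
  ⟨aestronglyMeasurable_convolution_mul hK.1 hf.1,
    (eLpNorm_convolution_mul_le hK.1 hf.1 hp hp').trans_lt (ENNReal.mul_lt_top hK.2 hf.2)⟩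

/-- The integral defining the convolution of an `L¹` and an `L^p` function converges absolutely
at almost every point. -/
theorem ae_integrable_mul_sub {p : ℝ≥0∞} (hf : MemLp f p) (hK : Integrable K) (hp : 1 ≤ p)
    (hp' : p ≠ ∞) : ∀ᵐ x, Integrable fun y => K y * f (x - y) := by
  have hp1 : 1 ≤ p.toReal := by simpa using (ENNReal.toReal_le_toReal (by simp) hp').2 hp
  have hpos : 0 < p.toReal := one_pos.trans_le hp1
  have hp0 : p ≠ 0 := (one_pos.trans_le hp).ne'
  have hsub : AEMeasurable (fun z : E × E => f (z.1 - z.2)) (volume.prod volume) :=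
    hf.1.aemeasurable.comp_quasiMeasurePreserving
      (quasiMeasurePreserving_sub_of_right_invariant volume volume)
  have hfin : ∫⁻ x, (∫⁻ y, ‖K y‖ₑ * ‖f (x - y)‖ₑ) ^ p.toReal ≠ ∞ := by
    refine ((lintegral_rpow_lintegral_mul_sub_le hK.1.enorm hf.1.enorm hp1).trans_lt ?_).ne
    exact ENNReal.mul_lt_top (ENNReal.rpow_lt_top_of_nonneg hpos.le hK.2.ne)
      ((eLpNorm_lt_top_iff_lintegral_rpow_enorm_lt_top hp0 hp').1 hf.2)
  filter_upwards [ae_lt_top' (((hK.1.enorm.comp_snd).mul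
    hsub.enorm).lintegral_prod_right'.pow_const _) hfin] with x hx
  refine ⟨hK.1.mul (hf.1.comp_quasiMeasurePreserving
    (quasiMeasurePreserving_sub_left_of_right_invariant volume x)), ?_⟩
  simpa [HasFiniteIntegral, enorm_mul] using (ENNReal.rpow_lt_top_iff_of_pos hpos).1 hx

theorem convolution_mul_congr_right {f g : E → ℂ} (K : E → ℂ) (h : f =ᵐ[volume] g) :
    (K ⋆[ContinuousLinearMap.mul ℂ ℂ] f) = K ⋆[ContinuousLinearMap.mul ℂ ℂ] g := by
  ext x
  refine integral_congr_ae ?_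
  filter_upwards [(quasiMeasurePreserving_sub_left_of_right_invariant volume x).ae_eq_comp h]
    with y hy
  simp only [Function.comp_apply] at hy
  simp [hy]

/-- Convolution with a fixed integrable kernel, as a bounded operator on `L²`. -/
noncomputable def convolutionL2 (hK : Integrable K) :
    Lp (α := E) ℂ 2 →L[ℂ] Lp (α := E) ℂ 2 :=
  LinearMap.mkContinuous
    { toFun := fun f => ((Lp.memLp f).convolution_mul hK one_le_two (by simp)).toLp _
      map_add' := fun f g => by
        ext1
        filter_upwards [MemLp.coeFn_toLp ((Lp.memLp (f + g)).convolution_mul hK one_le_two (by simp)),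
          MemLp.coeFn_toLp ((Lp.memLp f).convolution_mul hK one_le_two (by simp)),
          MemLp.coeFn_toLp ((Lp.memLp g).convolution_mul hK one_le_two (by simp)),
          Lp.coeFn_add (((Lp.memLp f).convolution_mul hK one_le_two (by simp)).toLp _)
            (((Lp.memLp g).convolution_mul hK one_le_two (by simp)).toLp _),
          ae_integrable_mul_sub (Lp.memLp f) hK one_le_two (by simp),
          ae_integrable_mul_sub (Lp.memLp g) hK one_le_two (by simp)] with x h1 h2 h3 h4 h5 h6
        rw [h1, h4, Pi.add_apply, h2, h3, convolution_mul_congr_right K (Lp.coeFn_add f g)]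
        simp only [convolution_def, ContinuousLinearMap.mul_apply', Pi.add_apply, mul_add]
        exact integral_add h5 h6
      map_smul' := fun c f => by
        ext1
        filter_upwards [MemLp.coeFn_toLp ((Lp.memLp (c • f)).convolution_mul hK one_le_two (by simp)),
          MemLp.coeFn_toLp ((Lp.memLp f).convolution_mul hK one_le_two (by simp)),
          Lp.coeFn_smul c (((Lp.memLp f).convolution_mul hK one_le_two (by simp)).toLp _)]
          with x h1 h2 h3
        rw [h1, RingHom.id_apply, h3, Pi.smul_apply, h2,
          convolution_mul_congr_right K (Lp.coeFn_smul c f)]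
        simp only [convolution_def, ContinuousLinearMap.mul_apply', Pi.smul_apply, smul_eq_mul,
          mul_left_comm _ c]
        exact integral_const_mul c _ }
    (∫⁻ y, ‖K y‖ₑ).toReal fun f => by
      rw [Lp.norm_def, Lp.norm_def, ← ENNReal.toReal_mul]
      refine ENNReal.toReal_mono (ENNReal.mul_ne_top hK.2.ne (Lp.memLp f).2.ne) ?_
      refine (eLpNorm_congr_ae (MemLp.coeFn_toLp
        ((Lp.memLp f).convolution_mul hK one_le_two (by simp)))).trans_le ?_
      exact eLpNorm_convolution_mul_le hK.1 (Lp.memLp f).1 one_le_two (by simp)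

theorem coeFn_convolutionL2 (hK : Integrable K) (f : Lp (α := E) ℂ 2) :
    convolutionL2 hK f =ᵐ[volume] K ⋆[ContinuousLinearMap.mul ℂ ℂ] f :=
  MemLp.coeFn_toLp ((Lp.memLp f).convolution_mul hK one_le_two (by simp))

end Convolution

/-! ### The Fourier transform on `L²` and on `L¹` -/

section FourierL2

open scoped Convolution

variable {E : Type*} [NormedAddCommGroup E] [InnerProductSpace ℝ E] [FiniteDimensional ℝ E]
  [MeasurableSpace E] [BorelSpace E]

theorem continuous_fourier_of_integrable {g : E → ℂ} (hg : Integrable g) : Continuous (𝓕 g) :=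
  VectorFourier.fourierIntegral_continuous Real.continuous_fourierChar
    (by exact continuous_inner) hg

/-- On `L¹ ∩ L²` the Fourier transform of `L²` is the Fourier integral. -/
theorem fourier_toLp_ae_eq {g : E → ℂ} (hg : Integrable g) (hg2 : MemLp g 2) :
    (𝓕 (hg2.toLp g) : Lp (α := E) ℂ 2) =ᵐ[volume] 𝓕 g := by
  set u : Lp (α := E) ℂ 2 := hg2.toLp g
  obtain ⟨v, hv⟩ : ∃ v : Lp (α := E) ℂ 2, v = 𝓕 u := ⟨_, rfl⟩
  rw [← hv]
  -- both sides have the same integral against test functions, since both transforms are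
  -- self-adjoint for the bilinear pairing
  refine ae_eq_of_integral_contDiff_smul_eq ((Lp.memLp _).locallyIntegrable one_le_two)
    ((continuous_fourier_of_integrable hg).locallyIntegrable (μ := volume)) fun s hs hsc => ?_
  have hc : HasCompactSupport (Complex.ofRealCLM ∘ s) := hsc.comp_left rfl
  have hd : ContDiff ℝ (⊤ : ℕ∞) (Complex.ofRealCLM ∘ s) := by fun_prop
  set S : 𝓢(E, ℂ) := hc.toSchwartzMap hd with hS
  have hSx : ∀ x, S x = (s x : ℂ) := fun x => by simp [hS]
  calc ∫ x, s x • v x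
      = Lp.toTemperedDistribution v S := by
        simp [Lp.toTemperedDistribution_apply, hSx]
    _ = ∫ x, 𝓕 S x • u x := by
        rw [hv, ← Lp.fourier_toTemperedDistribution_eq, TemperedDistribution.fourier_apply,
          Lp.toTemperedDistribution_apply]
    _ = ∫ x, 𝓕 (S : E → ℂ) x • g x := by
        refine integral_congr_ae ?_
        filter_upwards [hg2.coeFn_toLp] with x hx
        rw [hx, SchwartzMap.fourier_coe]
    _ = ∫ x, S x • 𝓕 g x :=
        (VectorFourier.integral_fourierIntegral_smul_eq_flip (L := innerₗ E)
          Real.continuous_fourierChar continuous_inner (S.integrable (μ := volume)) hg).trans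
          (by rw [flip_innerₗ]; rfl)
    _ = ∫ x, s x • 𝓕 g x := by simp [hSx]

theorem memLp_top_fourier {K : E → ℂ} (hK : Integrable K) : MemLp (𝓕 K) ∞ :=
  memLp_top_of_bound (continuous_fourier_of_integrable hK).aestronglyMeasurable (∫ x, ‖K x‖)
    (ae_of_all _ fun ξ => VectorFourier.norm_fourierIntegral_le_integral_norm _ _ _ _ ξ)

/-- The convolution theorem for an `L¹` kernel acting on `L²`. -/
theorem fourier_convolutionL2 {K : E → ℂ} (hK : Integrable K) (f : Lp (α := E) ℂ 2) :
    𝓕 (convolutionL2 hK f) = (memLp_top_fourier hK).toLp (𝓕 K) • 𝓕 f := by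
  -- both sides are continuous in `f`, so it suffices to treat Schwartz functions
  refine DenseRange.induction_on
    (p := fun f => 𝓕 (convolutionL2 hK f) = (memLp_top_fourier hK).toLp (𝓕 K) • 𝓕 f)
    (SchwartzMap.denseRange_toLpCLM (p := 2) ENNReal.ofNat_ne_top) f ?_ ?_
  · refine isClosed_eq ?_ ?_
    · exact (FourierTransform.fourierCLM ℂ (Lp (α := E) ℂ 2) ∘L convolutionL2 hK).continuous
    · exact ((ContinuousLinearMap.lsmul ℂ ℂ).holderL volume ∞ 2 2
        ((memLp_top_fourier hK).toLp (𝓕 K)) ∘L FourierTransform.fourierCLM ℂ (Lp (α := E) ℂ 2)).continuous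
  · intro f
    have hint : Integrable (K ⋆[ContinuousLinearMap.mul ℂ ℂ] f) :=
      hK.integrable_convolution _ f.integrable
    have h2 : MemLp (K ⋆[ContinuousLinearMap.mul ℂ ℂ] f) 2 :=
      (f.memLp 2).convolution_mul hK one_le_two (by simp)
    have hconv : convolutionL2 hK (f.toLp 2) = h2.toLp _ := by
      ext1
      refine (coeFn_convolutionL2 hK _).trans ?_
      rw [convolution_mul_congr_right K (f.coeFn_toLp 2 volume)]
      exact h2.coeFn_toLp.symm
    simp only [SchwartzMap.toLpCLM_apply, hconv]
    rw [SchwartzMap.toLp_fourier_eq]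
    ext1
    filter_upwards [fourier_toLp_ae_eq hint h2,
      Lp.coeFn_lpSMul (r := 2) ((memLp_top_fourier hK).toLp (𝓕 K)) ((𝓕 f).toLp 2),
      (memLp_top_fourier hK).coeFn_toLp, (𝓕 f).coeFn_toLp 2 volume] with ξ h3 h4 h5 h6
    rw [h3, h4, Pi.smul_apply', h5, h6, Real.fourier_mul_convolution_eq hK f.integrable,
      SchwartzMap.fourier_coe, smul_eq_mul]

/-! ### Multiplication by a symbol of temperate growth -/

/-- If the tempered distribution `g u` is an `L²` function, it is the pointwise product. -/
theorem smulLeftCLM_eq_iff {g : E → ℂ} (hg : g.HasTemperateGrowth) (u v : Lp (α := E) ℂ 2) :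
    smulLeftCLM ℂ g (u : 𝓢'(E, ℂ)) = (v : 𝓢'(E, ℂ)) ↔ v =ᵐ[volume] fun x => g x * u x := by
  constructor
  · intro h
    have hloc : LocallyIntegrable (fun x => g x * u x) := by
      have := ((Lp.memLp u).locallyIntegrable one_le_two).locallyIntegrableOn Set.univ
      simpa [locallyIntegrableOn_univ] using
        this.continuousOn_mul hg.1.continuous.continuousOn isClosed_univ.isLocallyClosed
    refine ae_eq_of_integral_contDiff_smul_eq ((Lp.memLp _).locallyIntegrable one_le_two)
      hloc fun s hs hsc => ?_
    have hc : HasCompactSupport (Complex.ofRealCLM ∘ s) := hsc.comp_left rfl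
    have hd : ContDiff ℝ (⊤ : ℕ∞) (Complex.ofRealCLM ∘ s) := by fun_prop
    have h1 := DFunLike.congr_fun h (hc.toSchwartzMap hd)
    simp only [smulLeftCLM_apply_apply, Lp.toTemperedDistribution_apply,
      SchwartzMap.smulLeftCLM_apply_apply hg] at h1
    simpa [mul_assoc, mul_left_comm] using h1.symm
  · intro h
    ext s
    simp only [smulLeftCLM_apply_apply, Lp.toTemperedDistribution_apply]
    refine integral_congr_ae ?_
    filter_upwards [h] with x hx
    simp only [SchwartzMap.smulLeftCLM_apply_apply hg, hx, smul_eq_mul]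
    ring

/-- A Fourier multiplier in the sense of distributions that maps `u ∈ L²` to `v ∈ L²` acts by
pointwise multiplication of the `L²` Fourier transforms. -/
theorem fourierMultiplierCLM_eq_iff {g : E → ℂ} (hg : g.HasTemperateGrowth)
    (u v : Lp (α := E) ℂ 2) :
    fourierMultiplierCLM ℂ g (u : 𝓢'(E, ℂ)) = (v : 𝓢'(E, ℂ)) ↔
      (𝓕 v : Lp (α := E) ℂ 2) =ᵐ[volume] fun ξ => g ξ * (𝓕 u : Lp (α := E) ℂ 2) ξ := by
  rw [← smulLeftCLM_eq_iff hg, ← Lp.fourier_toTemperedDistribution_eq,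
    ← Lp.fourier_toTemperedDistribution_eq, fourierMultiplierCLM_apply]
  constructor
  · intro h
    rw [← h, FourierTransform.fourier_fourierInv_eq]
  · intro h
    rw [h, FourierTransform.fourierInv_fourier_eq]

theorem toTemperedDistribution_injective :
    Function.Injective fun u : Lp (α := E) ℂ 2 => (u : 𝓢'(E, ℂ)) :=
  LinearMap.ker_eq_bot.1 (Lp.ker_toTemperedDistributionCLM_eq_bot (E := E) (F := ℂ)
    (μ := volume) (p := 2))

/-! ### Decay of the Fourier transform of a differentiable function of compact support -/

/-- Plancherel's theorem for the `k`-th derivative of `χ` in the direction `m`. -/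
theorem memLp_inner_pow_mul_fourier {χ : E → ℂ} {k : ℕ} (hχ : ContDiff ℝ k χ)
    (hs : HasCompactSupport χ) (m : E) :
    MemLp (fun ξ => (inner ℝ ξ m : ℂ) ^ k * 𝓕 χ ξ) 2 := by
  have hint : ∀ n : ℕ, n ≤ (k : ℕ∞) → Integrable (iteratedFDeriv ℝ n χ) := fun n hn =>
    (hχ.continuous_iteratedFDeriv (by exact_mod_cast hn)).integrable_of_hasCompactSupport
      (hs.iteratedFDeriv n)
  set g : E → ℂ := fun x => iteratedFDeriv ℝ k χ x fun _ => m with hg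
  have hgc : Continuous g :=
    (ContinuousMultilinearMap.apply ℝ (fun _ : Fin k => E) ℂ fun _ => m).continuous.comp
      (hχ.continuous_iteratedFDeriv le_rfl)
  have hgs : HasCompactSupport g :=
    (hs.iteratedFDeriv (𝕜 := ℝ) k).comp_left
      (g := fun L : ContinuousMultilinearMap ℝ (fun _ : Fin k => E) ℂ => L fun _ => m) rfl
  have hg1 : Integrable g := hgc.integrable_of_hasCompactSupport hgs
  have hg2 : MemLp g 2 := hgc.memLp_of_hasCompactSupport hgs
  have hF : ∀ ξ, 𝓕 g ξ = (2 * Real.pi * Complex.I) ^ k * ((inner ℝ ξ m : ℂ) ^ k * 𝓕 χ ξ) := by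
    intro ξ
    rw [hg, ← Real.fourier_continuousMultilinearMap_apply (hint k le_rfl),
      Real.fourier_iteratedFDeriv (N := k) hχ hint le_rfl]
    simp only [VectorFourier.fourierPowSMulRight_apply, Finset.prod_const, Finset.card_univ,
      Fintype.card_fin, neg_apply, Complex.real_smul,
      smul_eq_mul, neg_pow (2 * (Real.pi : ℂ) * Complex.I)]
    have h1 : ((-1 : ℂ) ^ k) * (-1) ^ k = 1 := by rw [← mul_pow]; simp
    push_cast
    change _ * _ * ((-((inner ℝ ξ m : ℝ) : ℂ)) ^ k * _) = _
    rw [neg_pow (inner ℝ ξ m : ℂ)]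
    linear_combination (2 * Real.pi * Complex.I) ^ k * ((inner ℝ ξ m : ℂ) ^ k * 𝓕 χ ξ) * h1
  have hc : ((2 * Real.pi * Complex.I) ^ k : ℂ) ≠ 0 := by
    simp [Real.pi_ne_zero]
  have h2 : MemLp (𝓕 g) 2 := (Lp.memLp _).ae_eq (fourier_toLp_ae_eq hg1 hg2)
  refine (h2.const_mul ((2 * Real.pi * Complex.I) ^ k : ℂ)⁻¹).ae_eq (ae_of_all _ fun ξ => ?_)
  simp only [hF]
  field_simp

theorem one_add_norm_pow_le {V : Type*} [NormedAddCommGroup V] [InnerProductSpace ℝ V]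
    [FiniteDimensional ℝ V] (n : ℕ) (ξ : V) :
    (1 + ‖ξ‖) ^ (n + 1) ≤ ((Module.finrank ℝ V : ℝ) + 1) ^ n *
      (1 + ∑ i, ‖inner ℝ ξ (stdOrthonormalBasis ℝ V i)‖ ^ (n + 1)) := by
  set b := stdOrthonormalBasis ℝ V
  have h1 : ‖ξ‖ ≤ ∑ i, ‖inner ℝ ξ (b i)‖ := by
    conv_lhs => rw [← b.sum_repr' ξ]
    refine (norm_sum_le _ _).trans (Finset.sum_le_sum fun i _ => ?_)
    rw [norm_smul, b.norm_eq_one, mul_one, real_inner_comm]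
  -- convexity of the power function, for the sum of `1` and the coordinates of `ξ`
  have h2 := pow_sum_div_card_le_sum_pow (s := Finset.univ)
    (f := fun o : Option (Fin (Module.finrank ℝ V)) => o.elim (1 : ℝ) fun i => ‖inner ℝ ξ (b i)‖)
    (by rintro (_ | i) _ <;> simp) n
  simp only [Fintype.sum_option, Option.elim, one_pow, Finset.card_univ, Fintype.card_option,
    Fintype.card_fin, Nat.cast_add, Nat.cast_one] at h2
  rw [div_le_iff₀ (by positivity)] at h2
  rw [mul_comm]
  refine le_trans ?_ h2
  gcongr

/-- The Cauchy–Schwarz argument: `(1 + |ξ|)^k 𝓕χ` and `(1 + |ξ|)^(1 - k)` are square integrable. -/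
theorem integrable_one_add_norm_mul_fourier {χ : E → ℂ} {k : ℕ} (hχ : ContDiff ℝ k χ)
    (hs : HasCompactSupport χ) (hk : 1 + (Module.finrank ℝ E : ℝ) / 2 < k) :
    Integrable fun ξ => (1 + ‖ξ‖) * ‖𝓕 χ ξ‖ := by
  obtain ⟨n, rfl⟩ : ∃ n, k = n + 1 := by
    refine Nat.exists_eq_succ_of_ne_zero ?_
    rintro rfl
    have : (0 : ℝ) ≤ Module.finrank ℝ E := by positivity
    push_cast at hk
    linarith
  have hχ1 : Integrable χ := hχ.continuous.integrable_of_hasCompactSupport hs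
  have hcont := continuous_fourier_of_integrable hχ1
  have h0 : MemLp (𝓕 χ) 2 := (Lp.memLp _).ae_eq
    (fourier_toLp_ae_eq hχ1 (hχ.continuous.memLp_of_hasCompactSupport hs))
  have hA : MemLp (fun ξ => (1 + ‖ξ‖) ^ (n + 1) * ‖𝓕 χ ξ‖) 2 := by
    have hsum := h0.norm.add (memLp_finsetSum Finset.univ fun i _ =>
      (memLp_inner_pow_mul_fourier hχ hs (stdOrthonormalBasis ℝ E i)).norm)
    refine MemLp.of_le_mul hsum (c := ((Module.finrank ℝ E : ℝ) + 1) ^ n)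
      (by fun_prop) (ae_of_all _ fun ξ => ?_)
    rw [Real.norm_of_nonneg (by positivity), Pi.add_apply, Real.norm_of_nonneg (by positivity)]
    refine (mul_le_mul_of_nonneg_right (one_add_norm_pow_le n ξ) (norm_nonneg _)).trans_eq ?_
    simp only [norm_mul, norm_pow, Complex.norm_real, mul_assoc, add_mul, one_mul, Finset.sum_mul]
  have hB : MemLp (fun ξ : E => (1 + ‖ξ‖) ^ (-(n : ℝ))) 2 := by
    rw [memLp_two_iff_integrable_sq]
    · have hr : (Module.finrank ℝ E : ℝ) < 2 * n := by push_cast at hk; linarith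
      refine (integrable_one_add_norm (μ := volume) hr).congr (ae_of_all _ fun ξ => ?_)
      simp only
      rw [← Real.rpow_mul_natCast (by positivity)]
      congr 1
      push_cast
      ring
    · refine Continuous.aestronglyMeasurable ?_
      exact Continuous.rpow_const (by fun_prop) fun ξ => Or.inl (by positivity)
  refine (hB.integrable_mul hA).congr (ae_of_all _ fun ξ => ?_)
  have hpos : 0 < 1 + ‖ξ‖ := by positivity
  simp only [Pi.mul_apply]
  rw [Real.rpow_neg hpos.le, Real.rpow_natCast, pow_succ]
  field_simp

end FourierL2

/-! ### Dilated kernels -/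

section Dilation

variable {E : Type*} [NormedAddCommGroup E] [InnerProductSpace ℝ E] [FiniteDimensional ℝ E]
  [MeasurableSpace E] [BorelSpace E]

/-- The `L¹`-normalised dilation `a^(-d) K(x / a)` of a kernel `K` on a space of dimension `d`. -/
noncomputable def dilate (K : E → ℂ) (a : ℝ) (x : E) : ℂ :=
  ((a ^ Module.finrank ℝ E)⁻¹ : ℝ) • K (a⁻¹ • x)

variable {K : E → ℂ} {a : ℝ}

theorem integrable_dilate (hK : Integrable K) (ha : 0 < a) : Integrable (dilate K a) :=
  (hK.comp_smul (inv_ne_zero ha.ne')).smul ((a ^ Module.finrank ℝ E)⁻¹ : ℝ)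

theorem fourier_dilate (K : E → ℂ) (ha : 0 < a) (ξ : E) : 𝓕 (dilate K a) ξ = 𝓕 K (a • ξ) := by
  have h := Measure.integral_comp_inv_smul_of_nonneg (volume : Measure E)
    (fun y => Real.fourierChar (-inner ℝ y (a • ξ)) • K y) (R := a) ha.le
  have hpos : a ^ Module.finrank ℝ E ≠ 0 := (pow_pos ha _).ne'
  rw [Real.fourier_eq, Real.fourier_eq]
  rw [← inv_smul_eq_iff₀ hpos] at h
  rw [← h, ← integral_smul]
  refine integral_congr_ae (ae_of_all _ fun x => ?_)
  have e : inner ℝ (a⁻¹ • x) (a • ξ) = inner ℝ x ξ := by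
    rw [real_inner_smul_left, real_inner_smul_right, inv_mul_cancel_left₀ ha.ne']
  simp only [dilate, e, smul_comm (Real.fourierChar _)]

theorem lintegral_enorm_mul_enorm_dilate (hK : Integrable fun x => ‖x‖ * ‖K x‖) (ha : 0 < a) :
    ∫⁻ x, ‖x‖ₑ * ‖dilate K a x‖ₑ = ENNReal.ofReal (a * ∫ x, ‖x‖ * ‖K x‖) := by
  have hpos : 0 < a ^ Module.finrank ℝ E := pow_pos ha _
  have e : (fun x => ‖x‖ * ‖dilate K a x‖) = fun x =>
      (a * (a ^ Module.finrank ℝ E)⁻¹) • (fun y => ‖y‖ * ‖K y‖) (a⁻¹ • x) := by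
    ext x
    simp only [dilate, norm_smul, norm_inv, norm_pow, Real.norm_of_nonneg ha.le, smul_eq_mul]
    field_simp
  have hint : Integrable fun x => ‖x‖ * ‖dilate K a x‖ := by
    rw [e]
    exact (hK.comp_smul (inv_ne_zero ha.ne')).smul (a * (a ^ Module.finrank ℝ E)⁻¹)
  have hval : ∫ x, ‖x‖ * ‖dilate K a x‖ = a * ∫ x, ‖x‖ * ‖K x‖ := by
    rw [e, integral_smul, Measure.integral_comp_inv_smul_of_nonneg volume (fun y => ‖y‖ * ‖K y‖) ha.le,
      smul_smul, smul_eq_mul]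
    field_simp
  rw [← hval, ofReal_integral_eq_lintegral_ofReal hint (ae_of_all _ fun x => by positivity)]
  refine lintegral_congr fun x => ?_
  rw [ENNReal.ofReal_mul (norm_nonneg _), ofReal_norm, ofReal_norm]

end Dilation

/-! ### Convolution operators and multiplication by the coordinates -/

section Coordinates

open scoped Convolution

variable {E : Type*} [NormedAddCommGroup E] [InnerProductSpace ℝ E] [FiniteDimensional ℝ E]
  [MeasurableSpace E] [BorelSpace E]

theorem memLp_norm_mul_convolution {K f : E → ℂ} (hK : Integrable K)
    (hK1 : ∫⁻ x, ‖x‖ₑ * ‖K x‖ₑ < ∞) (hf : MemLp f 2) (hf1 : MemLp (fun x => (‖x‖ : ℂ) * f x) 2) :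
    MemLp (fun x => (‖x‖ : ℂ) * (K ⋆[ContinuousLinearMap.mul ℂ ℂ] f) x) 2 := by
  have hn : Continuous fun x : E => (‖x‖ : ℂ) := by fun_prop
  -- the weight `1 + |x|` is submultiplicative, so it can be distributed over `K` and `f`
  have hw : MemLp (fun x => (1 + ‖x‖ : ℂ) * f x) 2 :=
    (hf.add hf1).ae_eq (ae_of_all _ fun x => by simp [add_mul])
  have hKw : AEMeasurable fun y => (1 + ‖y‖ₑ) * ‖K y‖ₑ :=
    (aemeasurable_const.add measurable_enorm.aemeasurable).mul hK.1.enorm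
  have hfin : ∫⁻ y, (1 + ‖y‖ₑ) * ‖K y‖ₑ < ∞ := by
    simp only [add_mul, one_mul]
    rw [lintegral_add_left' hK.1.enorm]
    exact ENNReal.add_lt_top.2 ⟨hK.2, hK1⟩
  refine ⟨hn.aestronglyMeasurable.mul (aestronglyMeasurable_convolution_mul hK.1 hf.1), ?_⟩
  refine (eLpNorm_le_of_enorm_le_lintegral hKw hw.1 one_le_two (by simp)
    (ae_of_all _ fun x => ?_)).trans_lt (ENNReal.mul_lt_top hfin hw.2)
  rw [enorm_mul]
  refine (mul_le_mul_right (enorm_convolution_mul_le K f x) _).trans ?_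
  rw [← lintegral_const_mul' _ _ enorm_ne_top]
  refine lintegral_mono fun y => ?_
  have h1 : ∀ z : E, ‖(1 + ‖z‖ : ℂ)‖ₑ = 1 + ‖z‖ₑ := fun z => by
    rw [← Complex.ofReal_one, ← Complex.ofReal_add, ← ofReal_norm, Complex.norm_real,
      Real.norm_of_nonneg (by positivity), ENNReal.ofReal_add zero_le_one (norm_nonneg _),
      ENNReal.ofReal_one, ofReal_norm]
  have h2 : ‖(‖x‖ : ℂ)‖ₑ ≤ (1 + ‖y‖ₑ) * (1 + ‖x - y‖ₑ) := by
    have h3 : ‖x‖ₑ ≤ ‖y‖ₑ + ‖x - y‖ₑ := by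
      simpa using enorm_add_le y (x - y)
    calc ‖(‖x‖ : ℂ)‖ₑ = ‖x‖ₑ := by simp [← ofReal_norm]
      _ ≤ ‖y‖ₑ + ‖x - y‖ₑ := h3
      _ ≤ (‖y‖ₑ + ‖x - y‖ₑ) + (1 + ‖y‖ₑ * ‖x - y‖ₑ) := le_self_add
      _ = _ := by ring
  calc ‖(‖x‖ : ℂ)‖ₑ * (‖K y‖ₑ * ‖f (x - y)‖ₑ)
      ≤ ((1 + ‖y‖ₑ) * (1 + ‖x - y‖ₑ)) * (‖K y‖ₑ * ‖f (x - y)‖ₑ) := by gcongr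
    _ = _ := by
      simp only [enorm_mul, h1]
      ring

/-- The commutator of a linear form `ℓ`, acting by multiplication, with convolution by `K` is
convolution by `ℓ K`, which is bounded pointwise by convolution of absolute values. -/
theorem ae_enorm_commutator_convolution_le {K f : E → ℂ} (ℓ : E →ₗ[ℝ] ℝ) (hℓ : ∀ x, ‖ℓ x‖ ≤ ‖x‖)
    (hK : Integrable K) (hf : MemLp f 2) (hf1 : MemLp (fun x => (ℓ x : ℂ) * f x) 2) :
    ∀ᵐ x, ‖(ℓ x : ℂ) * (K ⋆[ContinuousLinearMap.mul ℂ ℂ] f) x -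
      (K ⋆[ContinuousLinearMap.mul ℂ ℂ] fun x => (ℓ x : ℂ) * f x) x‖ₑ ≤
        ∫⁻ y, (‖y‖ₑ * ‖K y‖ₑ) * ‖f (x - y)‖ₑ := by
  filter_upwards [ae_integrable_mul_sub hf hK one_le_two (by simp),
    ae_integrable_mul_sub hf1 hK one_le_two (by simp)] with x h1 h2
  have e : (ℓ x : ℂ) * (K ⋆[ContinuousLinearMap.mul ℂ ℂ] f) x -
      (K ⋆[ContinuousLinearMap.mul ℂ ℂ] fun x => (ℓ x : ℂ) * f x) x =
        ∫ y, (ℓ y : ℂ) * (K y * f (x - y)) := by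
    simp only [convolution_def, ContinuousLinearMap.mul_apply']
    rw [← integral_const_mul, ← integral_sub (h1.const_mul _) h2]
    refine integral_congr_ae (ae_of_all _ fun y => ?_)
    simp only [map_sub, Complex.ofReal_sub]
    ring
  rw [e]
  refine (enorm_integral_le_lintegral_enorm _).trans (lintegral_mono fun y => ?_)
  have hy : ‖(ℓ y : ℂ)‖ₑ ≤ ‖y‖ₑ := by
    rw [enorm_le_iff_norm_le, Complex.norm_real]
    exact hℓ y
  rw [enorm_mul, enorm_mul, mul_assoc]
  gcongr

end Coordinates

/-! ### The frequency cut-off -/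

section Cutoff

open scoped Convolution

variable {d k : ℕ} {χ : EuclideanSpace ℝ (Fin d) → ℂ}

theorem IsCutoff.hasCompactSupport (hχ : IsCutoff d k χ) : HasCompactSupport χ :=
  (isCompact_closedBall _ _).of_isClosed_subset (isClosed_tsupport χ) hχ.support

theorem IsCutoff.integrable_one_add_norm_mul_fourierInv (hχ : IsCutoff d k χ) :
    Integrable fun x => (1 + ‖x‖) * ‖𝓕⁻ χ x‖ := by
  have h := (integrable_one_add_norm_mul_fourier hχ.contDiff hχ.hasCompactSupport
    (by simpa using hχ.order)).comp_neg
  simpa only [norm_neg, Real.fourierInv_eq_fourier_neg] using h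

theorem IsCutoff.continuous_fourierInv (hχ : IsCutoff d k χ) : Continuous (𝓕⁻ χ) := by
  have h := (continuous_fourier_of_integrable
    (hχ.contDiff.continuous.integrable_of_hasCompactSupport hχ.hasCompactSupport)).comp
      continuous_neg
  exact h.congr fun x => (Real.fourierInv_eq_fourier_neg χ x).symm

theorem IsCutoff.integrable_fourierInv (hχ : IsCutoff d k χ) : Integrable (𝓕⁻ χ) := by
  refine hχ.integrable_one_add_norm_mul_fourierInv.mono'
    hχ.continuous_fourierInv.aestronglyMeasurable (ae_of_all _ fun x => ?_)
  exact le_mul_of_one_le_left (norm_nonneg _) (by simp)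

theorem IsCutoff.integrable_norm_mul_fourierInv (hχ : IsCutoff d k χ) :
    Integrable fun x => ‖x‖ * ‖𝓕⁻ χ x‖ := by
  refine hχ.integrable_one_add_norm_mul_fourierInv.mono'
    (continuous_norm.mul hχ.continuous_fourierInv.norm).aestronglyMeasurable
    (ae_of_all _ fun x => ?_)
  rw [Real.norm_of_nonneg (by positivity)]
  gcongr
  simp

theorem IsCutoff.fourier_fourierInv (hχ : IsCutoff d k χ) : 𝓕 (𝓕⁻ χ) = χ := by
  refine hχ.contDiff.continuous.fourier_fourierInv_eq
    (hχ.contDiff.continuous.integrable_of_hasCompactSupport hχ.hasCompactSupport) ?_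
  have h := hχ.integrable_fourierInv.comp_neg
  simpa only [Real.fourierInv_eq_fourier_neg, neg_neg] using h

variable {τ : ℝ}

theorem dilation_pos (hτ : 0 < τ) : 0 < τ ^ (1 / 2 : ℝ) * (2 * Real.pi) := by positivity

theorem fourier_freqCutoff (hχ : IsCutoff d k χ) (τ : ℝ) (f : L2Space d) :
    (𝓕 (freqCutoff hχ τ f) : L2Space d) =ᵐ[volume]
      fun ξ => χ ((τ ^ (1 / 2 : ℝ) * (2 * Real.pi)) • ξ) * (𝓕 f : L2Space d) ξ := by
  rw [freqCutoff, FourierTransform.fourier_fourierInv_eq]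
  exact MemLp.coeFn_toLp _

/-- The frequency cut-off is the convolution with the dilated inverse Fourier transform of `χ`. -/
theorem freqCutoff_eq_convolutionL2 (hχ : IsCutoff d k χ) (hτ : 0 < τ) (f : L2Space d) :
    freqCutoff hχ τ f =
      convolutionL2 (integrable_dilate hχ.integrable_fourierInv (dilation_pos hτ)) f := by
  set hK := integrable_dilate hχ.integrable_fourierInv (dilation_pos hτ)
  refine (Lp.fourierTransformₗᵢ (EuclideanSpace ℝ (Fin d)) ℂ).injective ?_
  change (𝓕 (freqCutoff hχ τ f) : L2Space d) = 𝓕 (convolutionL2 hK f)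
  rw [fourier_convolutionL2]
  ext1
  filter_upwards [fourier_freqCutoff hχ τ f,
    Lp.coeFn_lpSMul (r := 2) ((memLp_top_fourier hK).toLp _) (𝓕 f : L2Space d),
    (memLp_top_fourier hK).coeFn_toLp] with ξ h1 h2 h3
  rw [h1, h2, Pi.smul_apply', h3, fourier_dilate _ (dilation_pos hτ), hχ.fourier_fourierInv,
    smul_eq_mul]

/-- The frequency cut-off commutes with every Fourier multiplier. -/
theorem fourierMultiplierCLM_freqCutoff (hχ : IsCutoff d k χ) (τ : ℝ)
    {g : EuclideanSpace ℝ (Fin d) → ℂ} (hg : g.HasTemperateGrowth) {u v : L2Space d}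
    (h : fourierMultiplierCLM ℂ g (u : 𝓢'(EuclideanSpace ℝ (Fin d), ℂ)) =
      (v : 𝓢'(EuclideanSpace ℝ (Fin d), ℂ))) :
    fourierMultiplierCLM ℂ g (freqCutoff hχ τ u : 𝓢'(EuclideanSpace ℝ (Fin d), ℂ)) =
      (freqCutoff hχ τ v : 𝓢'(EuclideanSpace ℝ (Fin d), ℂ)) := by
  rw [fourierMultiplierCLM_eq_iff hg] at h ⊢
  filter_upwards [h, fourier_freqCutoff hχ τ u, fourier_freqCutoff hχ τ v] with ξ h1 h2 h3
  rw [h2, h3, h1]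
  ring

theorem memLp_norm_mul_iff (φ : L2Space d) :
    MemLp (fun x : EuclideanSpace ℝ (Fin d) => (‖x‖ : ℂ) * φ x) 2 ↔
      ∫⁻ x : EuclideanSpace ℝ (Fin d), ‖x‖ₑ ^ 2 * ‖φ x‖ₑ ^ 2 < ∞ := by
  have hn : Continuous fun x : EuclideanSpace ℝ (Fin d) => (‖x‖ : ℂ) := by fun_prop
  have hm : AEStronglyMeasurable fun x : EuclideanSpace ℝ (Fin d) => (‖x‖ : ℂ) * φ x :=
    hn.aestronglyMeasurable.mul (Lp.aestronglyMeasurable φ)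
  have e : ∀ x : EuclideanSpace ℝ (Fin d), ‖(‖x‖ : ℂ)‖ₑ = ‖x‖ₑ := fun x => by
    simp [← ofReal_norm]
  rw [MemLp, and_iff_right hm,
    eLpNorm_lt_top_iff_lintegral_rpow_enorm_lt_top (by norm_num) (by norm_num)]
  simp only [ENNReal.toReal_ofNat, ENNReal.rpow_ofNat, enorm_mul, mul_pow, e]

theorem lintegral_enorm_mul_enorm_dilate_fourierInv (hχ : IsCutoff d k χ) (hτ : 0 < τ) :
    ∫⁻ x, ‖x‖ₑ * ‖dilate (𝓕⁻ χ) (τ ^ (1 / 2 : ℝ) * (2 * Real.pi)) x‖ₑ =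
      ENNReal.ofReal (τ ^ (1 / 2 : ℝ) * (2 * Real.pi) * ∫ x, ‖x‖ * ‖𝓕⁻ χ x‖) :=
  lintegral_enorm_mul_enorm_dilate hχ.integrable_norm_mul_fourierInv (dilation_pos hτ)

theorem coeFn_freqCutoff (hχ : IsCutoff d k χ) (hτ : 0 < τ) (f : L2Space d) :
    freqCutoff hχ τ f =ᵐ[volume] dilate (𝓕⁻ χ) (τ ^ (1 / 2 : ℝ) * (2 * Real.pi))
      ⋆[ContinuousLinearMap.mul ℂ ℂ] f := by
  rw [freqCutoff_eq_convolutionL2 hχ hτ]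
  exact coeFn_convolutionL2 _ f

theorem freqCutoff_mem_conformalSpace (hχ : IsCutoff d k χ) (hτ : 0 < τ) {φ : L2Space d}
    (hφ : φ ∈ conformalSpace d) : freqCutoff hχ τ φ ∈ conformalSpace d := by
  constructor
  · obtain ⟨f, hf⟩ := hφ.1
    exact ⟨freqCutoff hχ τ f, fourierMultiplierCLM_freqCutoff hχ τ (by fun_prop) hf⟩
  · rw [← memLp_norm_mul_iff]
    have hK := integrable_dilate hχ.integrable_fourierInv (dilation_pos hτ)
    refine (memLp_norm_mul_convolution hK ?_ (Lp.memLp φ)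
      ((memLp_norm_mul_iff φ).2 hφ.2)).ae_eq ?_
    · rw [lintegral_enorm_mul_enorm_dilate_fourierInv hχ hτ]
      exact ENNReal.ofReal_lt_top
    · filter_upwards [coeFn_freqCutoff hχ hτ φ] with x hx
      rw [hx]

theorem weakPartial_freqCutoff (hχ : IsCutoff d k χ) (φ : conformalSpace d)
    (hφ : freqCutoff hχ τ φ ∈ conformalSpace d) (j : Fin d) :
    weakPartial ⟨freqCutoff hχ τ φ, hφ⟩ j = freqCutoff hχ τ (weakPartial φ j) := by
  have h1 : (∂_{EuclideanSpace.single j (1 : ℝ)} ((φ : L2Space d) :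
      𝓢'(EuclideanSpace ℝ (Fin d), ℂ)) : 𝓢'(EuclideanSpace ℝ (Fin d), ℂ)) = weakPartial φ j :=
    (exists_weakPartial φ.2 j).choose_spec
  have h2 : (∂_{EuclideanSpace.single j (1 : ℝ)} (freqCutoff hχ τ φ :
      𝓢'(EuclideanSpace ℝ (Fin d), ℂ)) : 𝓢'(EuclideanSpace ℝ (Fin d), ℂ)) =
        weakPartial ⟨freqCutoff hχ τ φ, hφ⟩ j :=
    (exists_weakPartial hφ j).choose_spec
  have hg : (fun x : EuclideanSpace ℝ (Fin d) =>
      ((inner ℝ x (EuclideanSpace.single j (1 : ℝ)) : ℝ) : ℂ)).HasTemperateGrowth := by fun_prop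
  rw [lineDeriv_eq_fourierMultiplierCLM, ← smul_apply, ← fourierMultiplierCLM_smul hg] at h1 h2
  refine toTemperedDistribution_injective (h2.symm.trans ?_)
  exact fourierMultiplierCLM_freqCutoff hχ τ (by fun_prop) h1

/-- The commutator of `J(t)` with the frequency cut-off does not depend on `t`, because the
gradient commutes with the cut-off. -/
theorem opJ_freqCutoff_sub (hχ : IsCutoff d k χ) (hτ : 0 < τ) (φ : conformalSpace d)
    (hφ : freqCutoff hχ τ φ ∈ conformalSpace d) (t : ℝ) (j : Fin d) :
    ∀ᵐ x, opJ t ⟨freqCutoff hχ τ φ, hφ⟩ j x - freqCutoff hχ τ (opJ t φ j) x =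
      (x j : ℂ) * freqCutoff hχ τ φ x -
        freqCutoff hχ τ ((memLp_coord_mul φ.2 j).toLp _) x := by
  have h : opJ t ⟨freqCutoff hχ τ φ, hφ⟩ j - freqCutoff hχ τ (opJ t φ j) =
      (memLp_coord_mul hφ j).toLp _ - freqCutoff hχ τ ((memLp_coord_mul φ.2 j).toLp _) := by
    rw [opJ, opJ, weakPartial_freqCutoff]
    simp only [freqCutoff_eq_convolutionL2 hχ hτ, map_add, map_smul]
    abel
  filter_upwards [Lp.coeFn_sub (opJ t ⟨freqCutoff hχ τ φ, hφ⟩ j) (freqCutoff hχ τ (opJ t φ j)),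
    Lp.coeFn_sub ((memLp_coord_mul hφ j).toLp _)
      (freqCutoff hχ τ ((memLp_coord_mul φ.2 j).toLp _)),
    (memLp_coord_mul hφ j).coeFn_toLp] with x h1 h2 h3
  rw [← Pi.sub_apply, ← h1, h, h2, Pi.sub_apply, h3]

theorem ae_enorm_opJ_freqCutoff_sub_le (hχ : IsCutoff d k χ) (hτ : 0 < τ) (φ : conformalSpace d)
    (hφ : freqCutoff hχ τ φ ∈ conformalSpace d) (t : ℝ) (j : Fin d) :
    ∀ᵐ x, ‖opJ t ⟨freqCutoff hχ τ φ, hφ⟩ j x - freqCutoff hχ τ (opJ t φ j) x‖ₑ ≤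
      ∫⁻ y, (‖y‖ₑ * ‖dilate (𝓕⁻ χ) (τ ^ (1 / 2 : ℝ) * (2 * Real.pi)) y‖ₑ) *
        ‖(φ : L2Space d) (x - y)‖ₑ := by
  have hK := integrable_dilate hχ.integrable_fourierInv (dilation_pos hτ)
  filter_upwards [opJ_freqCutoff_sub hχ hτ φ hφ t j, coeFn_freqCutoff hχ hτ (φ : L2Space d),
    coeFn_freqCutoff hχ hτ ((memLp_coord_mul φ.2 j).toLp _),
    ae_enorm_commutator_convolution_le (EuclideanSpace.proj j : _ →L[ℝ] ℝ).toLinearMap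
      (fun x => PiLp.norm_apply_le x j) hK (Lp.memLp (φ : L2Space d)) (memLp_coord_mul φ.2 j)]
    with x h1 h2 h3 h4
  rw [h1, h2, h3, convolution_mul_congr_right _ (memLp_coord_mul φ.2 j).coeFn_toLp]
  exact h4

theorem enorm_toLp_le_sum (v : Fin d → ℂ) : ‖WithLp.toLp 2 v‖ₑ ≤ ∑ j, ‖v j‖ₑ := by
  have h := (EuclideanSpace.basisFun (Fin d) ℂ).sum_repr (WithLp.toLp 2 v)
  rw [← h]
  refine (enorm_sum_le _ _).trans (Finset.sum_le_sum fun j _ => ?_)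
  rw [enorm_smul]
  simp [enorm_eq_nnnorm]

end Cutoff

theorem mainTheorem7 (d k : ℕ) (χ : EuclideanSpace ℝ (Fin d) → ℂ) (hχ : IsCutoff d k χ)
    (p : ℝ≥0∞) (hp : 1 < p) (hp' : p < ∞) :
    ∃ C : ℝ, 0 < C ∧ ∀ τ : ℝ, 0 < τ → ∀ (φ : conformalSpace d),
      ∃ hφ : freqCutoff hχ τ φ ∈ conformalSpace d, ∀ t : ℝ,
        eLpNorm (fun x : EuclideanSpace ℝ (Fin d) => WithLp.toLp 2 fun j : Fin d =>
            opJ t ⟨freqCutoff hχ τ φ, hφ⟩ j x - freqCutoff hχ τ (opJ t φ j) x) p volume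
          ≤ ENNReal.ofReal (C * τ ^ (1 / 2 : ℝ)) * eLpNorm (φ : L2Space d) p volume := by
  set M : ℝ := ∫ x, ‖x‖ * ‖𝓕⁻ χ x‖
  have hM : 0 ≤ M := integral_nonneg fun x => by positivity
  -- the summand `1` only serves to make the constant positive
  refine ⟨d * (2 * Real.pi * M) + 1, by positivity, fun τ hτ φ =>
    ⟨freqCutoff_mem_conformalSpace hχ hτ φ.2, fun t => ?_⟩⟩
  set K := dilate (𝓕⁻ χ) (τ ^ (1 / 2 : ℝ) * (2 * Real.pi))
  have hK : Integrable K := integrable_dilate hχ.integrable_fourierInv (dilation_pos hτ)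
  have hKm : AEMeasurable fun y => ‖y‖ₑ * ‖K y‖ₑ := measurable_enorm.aemeasurable.mul hK.1.enorm
  refine (eLpNorm_le_of_enorm_le_lintegral (K := fun y => d * (‖y‖ₑ * ‖K y‖ₑ))
    (hKm.const_mul _) (Lp.aestronglyMeasurable (φ : L2Space d)) hp.le hp'.ne ?_).trans ?_
  · filter_upwards [ae_all_iff.2 fun j => ae_enorm_opJ_freqCutoff_sub_le hχ hτ φ
      (freqCutoff_mem_conformalSpace hχ hτ φ.2) t j] with x hx
    refine (enorm_toLp_le_sum _).trans ((Finset.sum_le_sum fun j _ => hx j).trans_eq ?_)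
    simp only [Finset.sum_const, Finset.card_univ, Fintype.card_fin, nsmul_eq_mul, mul_assoc]
    rw [lintegral_const_mul' _ _ (ENNReal.natCast_ne_top d)]
  · gcongr
    rw [lintegral_const_mul' _ _ (ENNReal.natCast_ne_top d),
      lintegral_enorm_mul_enorm_dilate_fourierInv hχ hτ, ← ENNReal.ofReal_natCast,
      ← ENNReal.ofReal_mul (Nat.cast_nonneg d)]
    refine ENNReal.ofReal_le_ofReal ?_
    have : 0 ≤ τ ^ (1 / 2 : ℝ) := by positivity
    linarith
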